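/- Let $T$ be an NIP theory, that is: there are no formula $\phi(\bar x,\bar y)$ and model of $T$ containing tuples $(\bar a_i : i\in\omega)$ and $(\bar b_I : I\subseteq\omega)$ such that $\phi(\bar a_i,\bar b_I)$ holds if and only if $i\in I$. Let $M\models T$ and let $K$ be a type-definable field over $M$: the underlying set (of finite tuples of a fixed length) and the graphs of addition and multiplication are given by partial types over $M$, and in every elementary extension $N$ of $M$ they define a field, denoted $K^N$. Assume that $K$ has characteristic $p>0$ and is infinite (i.e. $K^N$ is infinite for some elementary extension $N$ of $M$). An Artin-Schreier extension of a field $k$ of characteristic $p$ is an extension $k(\alpha)/k$ with $\alpha\notin k$ and $\alpha^p-\alpha\in k$; these are counted inside an algebraic closure of $k$. Then $K$ has either no, or unboundedly many, Artin-Schreier extensions: either $K^N$ has no Artin-Schreier extension for every elementary extension $N$ of $M$, or for every cardinal $\kappa$ there is an elementary extension $N$ of $M$ such that $K^N$ has more than $\kappa$ Artin-Schreier extensions. -/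

import Mathlib

open scoped FirstOrder

universe u v w

namespace NIPFields

/-! ### Artin-Schreier extensions -/

/-- `F / K` is an Artin-Schreier extension (for the prime `p`): `F = K(α)` for some
`α ∈ F \ K` with `α ^ p - α ∈ K`. -/
def IsArtinSchreier (p : ℕ) (K : Type*) (F : Type*) [Field K] [Field F] [Algebra K F] : Prop :=
  ∃ α : F, α ∉ Set.range (algebraMap K F) ∧ α ^ p - α ∈ Set.range (algebraMap K F) ∧
    IntermediateField.adjoin K {α} = ⊤

/-- The set of Artin-Schreier extensions of `K` inside its algebraic closure. -/
def artinSchreierExtensions (p : ℕ) (K : Type*) [Field K] :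
    Set (IntermediateField K (AlgebraicClosure K)) :=
  {E | IsArtinSchreier p K E}

/-! ### NIP theories -/

/-- `T` has the independence property: some formula `φ(x, y)` and some model of `T` contain tuples
`a i` (`i ∈ ω`) and `b I` (`I ⊆ ω`) such that `φ(a i, b I)` holds if and only if `i ∈ I`. -/
def HasIP {L : FirstOrder.Language.{u, v}} (T : L.Theory) : Prop :=
  ∃ (m n : ℕ) (φ : L.Formula (Fin m ⊕ Fin n)) (M : FirstOrder.Language.Theory.ModelType.{u, v, max u v} T)
    (a : ℕ → Fin m → M) (b : Set ℕ → Fin n → M),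
    ∀ (i : ℕ) (I : Set ℕ), φ.Realize (Sum.elim (a i) (b I)) ↔ i ∈ I

/-- `T` is NIP (dependent): it does not have the independence property. -/
def IsNIP {L : FirstOrder.Language.{u, v}} (T : L.Theory) : Prop :=
  ¬ HasIP T

/-! ### Type-definable fields -/

/-- The realizations in `N`, with parameters from `M` interpreted through `f : M → N`, of a partial
type over `M` in the variables `α`. Formulas with parameters in `M` are written as formulas whose
free variables are either elements of `M` (the parameters) or elements of `α`. -/
def realizations {L : FirstOrder.Language.{u, v}} {M : Type*} {N : Type*} {α : Type*} [L.Structure N]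
    (f : M → N) (π : Set (L.Formula (M ⊕ α))) : Set (α → N) :=
  {x | ∀ φ ∈ π, φ.Realize (Sum.elim f x)}

/-- A type-definable field over the structure `M`: partial types over `M` for the underlying
set and for the graphs of addition and multiplication, which define a field in every elementary
extension of `M`. -/
structure TypeDefinableField (L : FirstOrder.Language.{u, v}) (M : Type w) [L.Structure M] where
  /-- The length of the tuples that are elements of the field. -/
  arity : ℕ
  /-- The partial type that defines the underlying set. -/
  carrier : Set (L.Formula (M ⊕ Fin arity))
  /-- The partial type that defines, on the underlying set, the graph of addition. -/
  add : Set (L.Formula (M ⊕ (Fin arity ⊕ Fin arity ⊕ Fin arity)))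
  /-- The partial type that defines, on the underlying set, the graph of multiplication. -/
  mul : Set (L.Formula (M ⊕ (Fin arity ⊕ Fin arity ⊕ Fin arity)))
  isField : ∀ (N : Type (max u v w)) [L.Structure N] (f : M ↪ₑ[L] N),
    ∃ _ : Field (realizations f carrier), ∀ x y z : realizations f carrier,
      (x + y = z ↔ Sum.elim x.1 (Sum.elim y.1 z.1) ∈ realizations f add) ∧
      (x * y = z ↔ Sum.elim x.1 (Sum.elim y.1 z.1) ∈ realizations f mul)

namespace TypeDefinableField

variable {L : FirstOrder.Language.{u, v}} {M : Type w} [L.Structure M]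

/-- The set `K^N` of points of the type-definable field `K` in the elementary extension `N`. -/
def Points (K : TypeDefinableField L M) {N : Type (max u v w)} [L.Structure N]
    (f : M ↪ₑ[L] N) : Type (max u v w) :=
  realizations f K.carrier

/-- The field structure on `K^N`; it is determined by the two graphs. -/
noncomputable instance (K : TypeDefinableField L M) {N : Type (max u v w)} [L.Structure N]
    (f : M ↪ₑ[L] N) : Field (K.Points f) :=
  (K.isField N f).choose

/-- `K` has characteristic `p`. -/
def HasChar (K : TypeDefinableField L M) (p : ℕ) : Prop :=
  ∀ (N : Type (max u v w)) [L.Structure N] (f : M ↪ₑ[L] N), CharP (K.Points f) p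

/-- `K` is infinite, that is, has infinitely many points in some elementary extension (hence in
every sufficiently saturated one). -/
def IsInfinite (K : TypeDefinableField L M) : Prop :=
  ∃ (N : Type (max u v w)) (_ : L.Structure N) (f : M ↪ₑ[L] N), Infinite (K.Points f)

/-- `K` has no Artin-Schreier extensions, in any elementary extension `N` of `M`. -/
def HasNoArtinSchreier (K : TypeDefinableField L M) (p : ℕ) : Prop :=
  ∀ (N : Type (max u v w)) [L.Structure N] (f : M ↪ₑ[L] N),
    artinSchreierExtensions p (K.Points f) = ∅

/-- `K` has boundedly many Artin-Schreier extensions: their number is bounded by one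
cardinal for all elementary extensions `N` of `M`. -/
def HasBoundedlyManyArtinSchreier (K : TypeDefinableField L M) (p : ℕ) : Prop :=
  ∃ κ : Cardinal.{max u v w},
    ∀ (N : Type (max u v w)) [L.Structure N] (f : M ↪ₑ[L] N),
      Cardinal.mk (artinSchreierExtensions p (K.Points f)) ≤ κ

end TypeDefinableField

end NIPFields

/-! Let `H` be the image of `x ↦ x ^ p - x` in `K^N`. Each coset of `H` yields `K^N` itself or an
Artin-Schreier extension, with finite fibres, so a bound on the extensions bounds the index of `H`
by some infinite `κ`, uniformly in `N` (`mk_quotient_artinSchreierImage_le`). Suppose that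
extensions exist but are bounded in number, and take `N` with `H` proper and `K^N` larger than `κ ^
κ⁺`.

Small index lets the pigeonhole principle solve many conditions `a * b ∈ H` at once. This gives a
long sequence with `a i * b i ∉ H` and `a j * b i ∈ H` for `j < i` (`exists_chain`). Suitable
differences of two `b`'s also satisfy the conditions of the selected later indices, and sums of such
differences realize every subset of a finite index set (`exists_pattern`).

Membership in `H` is only type-definable with a quantifier in front, so NIP does not apply to it
directly. Since `y ^ p - y = c` has at most `p` solutions, `a * b ∉ H` is already detected by a
finite part of the type, with no saturation of `N` (`exists_finset_not_realize_exConj`). There are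
at most `κ` such finite parts, so the pattern can be chosen with a single one. Compactness then
yields one formula that separates the two kinds of entries of the pattern
(`exists_separating_formula`), and this formula has the independence property. -/

namespace NIPFields

/-! ### Artin-Schreier theory: extensions and cosets of the Artin-Schreier image -/

section ArtinSchreier

open Polynomial Cardinal

theorem degree_X_pow_sub_X_sub_C {K : Type*} [Field K] {p : ℕ} (hp : 1 < p) (c : K) :
    (X ^ p - X - C c : K[X]).degree = p := by
    compute_degree!
    · simp [hp.ne, show p ≠ 0 by omega]
    · exact max_eq_left (Nat.one_le_cast.2 hp.le)

theorem not_injective_of_pow_sub_eq {K : Type*} [Field K] {p : ℕ} (hp : 1 < p) {c : K}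
    {y : Fin (p + 1) → K} (hy : ∀ j, y j ^ p - y j = c) : ¬ Function.Injective y := by
  intro hinj
  have hd := degree_X_pow_sub_X_sub_C hp c
  have h0 := eq_zero_of_natDegree_lt_card_of_eval_eq_zero (X ^ p - X - C c : K[X]) hinj
    (fun j => by simp [hy]) (by rw [natDegree_eq_of_degree_eq_some hd, Fintype.card_fin]; omega)
  rw [h0, degree_zero] at hd
  exact WithBot.bot_ne_natCast p hd

/-- The image of the Artin-Schreier map `x ↦ x ^ p - x`. -/
def artinSchreierImage (p : ℕ) (K : Type*) [Field K] [Fact p.Prime] [CharP K p] :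
    AddSubgroup K :=
  ((frobenius K p).toAddMonoidHom - AddMonoidHom.id K).range

theorem mem_artinSchreierImage {p : ℕ} {K : Type*} [Field K] [Fact p.Prime] [CharP K p] {c : K} :
    c ∈ artinSchreierImage p K ↔ ∃ x : K, x ^ p - x = c :=
  Iff.rfl

variable {p : ℕ} {K : Type*} [Field K] [Fact p.Prime] [CharP K p]

/-- Two roots of `X ^ p - X - c` differ by a fixed point of Frobenius, that is, by an element of the
prime field. One root in `K` therefore puts all of them in `K`. -/
theorem artinSchreierExtensions_eq_empty (h : artinSchreierImage p K = ⊤) :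
    artinSchreierExtensions p K = ∅ := by
  rw [Set.eq_empty_iff_forall_notMem]
  rintro E ⟨α, hα, ⟨c, hc⟩, -⟩
  obtain ⟨x, hx⟩ := mem_artinSchreierImage.1 (h ▸ AddSubgroup.mem_top c)
  have : CharP E p := charP_of_injective_algebraMap (algebraMap K E).injective p
  have hfix : (α - algebraMap K E x) ^ p = α - algebraMap K E x := by
    rw [sub_pow_char, ← sub_eq_zero]
    have : α ^ p - α = algebraMap K E x ^ p - algebraMap K E x := by
      rw [← hc, ← hx, map_sub, map_pow]
    linear_combination this
  have hmem : α - algebraMap K E x ∈ (algebraMap K E).fieldRange :=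
    (bot_le : ⊥ ≤ (algebraMap K E).fieldRange) ((Subfield.mem_bot_iff_pow_eq_self E p).2 hfix)
  obtain ⟨y, hy⟩ := hmem
  exact hα ⟨y + x, by rw [map_add, hy]; ring⟩

theorem exists_artinSchreier_root (c : K) :
    ∃ x : AlgebraicClosure K, x ^ p - x = algebraMap K _ c ∧ IsSeparable K x := by
  have hp : 1 < p := (Fact.out : p.Prime).one_lt
  have hd : (X ^ p - X - C c : K[X]).degree = p := degree_X_pow_sub_X_sub_C hp c
  obtain ⟨x, hx⟩ := IsAlgClosed.exists_aeval_eq_zero (AlgebraicClosure K) (X ^ p - X - C c : K[X])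
    (by rw [hd]; exact_mod_cast (by omega))
  refine ⟨x, ?_, ?_⟩
  · simpa [sub_eq_zero] using hx
  · refine Polynomial.Separable.of_dvd ?_ (minpoly.dvd K x hx)
    have : derivative (X ^ p - X - C c : K[X]) = -1 := by
      simp [derivative_X_pow]
    rw [Polynomial.Separable, this]
    exact isCoprime_one_right.neg_right

theorem mem_range_algebraMap_of_forall_algEquiv {x : AlgebraicClosure K} (hx : IsSeparable K x)
    (h : ∀ σ : Gal(AlgebraicClosure K/K), σ x = x) : x ∈ Set.range (algebraMap K _) := by
  by_contra hn
  obtain ⟨y, hne, hy⟩ := (notMem_iff_exists_ne_and_isConjRoot hx (Normal.splits inferInstance x)).1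
    (fun hb => hn (by simpa [Algebra.mem_bot] using hb))
  obtain ⟨σ, rfl⟩ := isConjRoot_iff_exists_algEquiv.1 hy.symm
  exact hne (h σ).symm

/-- A root of `X ^ p - X - c` is chosen for a representative `c` of each coset, and the coset is
sent to the field generated by the root. Fibres are finite: for a fixed field `E`, a coset is
determined by how the finitely many embeddings of `E` move its root, and each of them moves it by a
root of `X ^ p - X`. -/
theorem mk_quotient_artinSchreierImage_le :
    #(K ⧸ artinSchreierImage p K) ≤ max #(artinSchreierExtensions p K) ℵ₀ := by
  classical
  have hp : 1 < p := (Fact.out : p.Prime).one_lt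
  have : CharP (AlgebraicClosure K) p :=
    charP_of_injective_algebraMap (algebraMap K (AlgebraicClosure K)).injective p
  choose r hr hrs using exists_artinSchreier_root (p := p) (K := K)
  let Q := K ⧸ artinSchreierImage p K
  -- `⊥` accounts for the coset whose chosen root already lies in `K`.
  let S : Set (IntermediateField K (AlgebraicClosure K)) := insert ⊥ (artinSchreierExtensions p K)
  have hS : ∀ q : Q, IntermediateField.adjoin K {r q.out} ∈ S := by
    intro q
    by_cases hq : r q.out ∈ Set.range (algebraMap K (AlgebraicClosure K))
    · refine Or.inl ?_
      rw [IntermediateField.adjoin_simple_eq_bot_iff, IntermediateField.mem_bot]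
      exact hq
    · refine Or.inr ⟨IntermediateField.AdjoinSimple.gen K (r q.out), ?_, ⟨q.out, ?_⟩, ?_⟩
      · rintro ⟨c, hc⟩
        exact hq ⟨c, by simpa using congrArg Subtype.val hc⟩
      · exact Subtype.ext (by simpa using (hr q.out).symm)
      · refine IntermediateField.lift_injective _ ?_
        rw [IntermediateField.lift_adjoin_simple, IntermediateField.lift_top,
          IntermediateField.AdjoinSimple.coe_gen]
  let f : Q → S := fun q => ⟨_, hS q⟩
  have hfin : ∀ E : S, #{q // f q = E} ≤ ℵ₀ := by
    rintro E
    by_cases hE : ∃ q, f q = E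
    swap
    · have : IsEmpty {q // f q = E} := ⟨fun q => hE ⟨q.1, q.2⟩⟩
      simp
    have hfd : FiniteDimensional K E.1 := by
      obtain ⟨q, rfl⟩ := hE
      exact IntermediateField.adjoin.finiteDimensional (Algebra.IsIntegral.isIntegral _)
    have hroots : Finite {x : AlgebraicClosure K // x ^ p - x = 0} := by
      have hne : (X ^ p - X : (AlgebraicClosure K)[X]) ≠ 0 := FiniteField.X_pow_card_sub_X_ne_zero _ hp
      refine ((X ^ p - X : (AlgebraicClosure K)[X]).rootSet_finite (AlgebraicClosure K)).subset ?_
      intro x hx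
      rw [Polynomial.mem_rootSet]
      have hx' : x ^ p - x = 0 := hx
      exact ⟨hne, by simpa using hx'⟩
    have hmem : ∀ q : {q // f q = E}, r q.1.out ∈ E.1 := by
      rintro ⟨q, rfl⟩
      exact IntermediateField.mem_adjoin_simple_self K _
    let g : {q // f q = E} → (E.1 →ₐ[K] AlgebraicClosure K) →
        {x : AlgebraicClosure K // x ^ p - x = 0} := fun q σ =>
      ⟨σ ⟨r q.1.out, hmem q⟩ - r q.1.out, by
        have h1 : σ ⟨r q.1.out, hmem q⟩ ^ p - σ ⟨r q.1.out, hmem q⟩ =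
            algebraMap K _ q.1.out := by
          rw [← map_pow, ← map_sub, ← σ.commutes]
          congr 1
          exact Subtype.ext (hr _)
        have h2 := hr q.1.out
        rw [sub_pow_char]
        linear_combination h1 - h2⟩
    have hg : Function.Injective g := by
      intro q q' hqq
      -- If all embeddings move the two roots by the same amounts, the difference of the roots is
      -- Galois-invariant. It is separable, hence lies in `K`.
      have hfix : ∀ σ : Gal(AlgebraicClosure K/K),
          σ (r q.1.out - r q'.1.out) = r q.1.out - r q'.1.out := by
        intro σ
        have := congrArg Subtype.val (congrFun hqq (σ.toAlgHom.comp E.1.val))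
        simp only [g] at this
        change σ (r q.1.out) - r q.1.out = σ (r q'.1.out) - r q'.1.out at this
        rw [map_sub]
        linear_combination this
      obtain ⟨d, hd⟩ := mem_range_algebraMap_of_forall_algEquiv
        (Field.isSeparable_sub (hrs q.1.out) (hrs q'.1.out)) hfix
      refine Subtype.ext ?_
      rw [← q.1.out_eq', ← q'.1.out_eq', Quotient.eq'', QuotientAddGroup.leftRel_apply,
        mem_artinSchreierImage]
      refine ⟨-d, (algebraMap K (AlgebraicClosure K)).injective ?_⟩
      have e1 := hr q.1.out
      have e2 := hr q'.1.out
      have e3 : (r q'.1.out - r q.1.out) ^ p - (r q'.1.out - r q.1.out) =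
          algebraMap K _ q'.1.out - algebraMap K _ q.1.out := by
        rw [sub_pow_char]
        linear_combination e2 - e1
      have e4 : algebraMap K (AlgebraicClosure K) (-d) = r q'.1.out - r q.1.out := by
        rw [map_neg, hd]; ring
      rw [map_sub, map_pow, e4, e3, map_add, map_neg]
      ring
    have := Finite.of_injective g hg
    exact mk_le_aleph0
  have hSle : #S ≤ max #(artinSchreierExtensions p K) ℵ₀ := by
    refine (mk_insert_le).trans ?_
    exact add_le_of_le (le_max_right _ _) (le_max_left _ _)
      (one_le_aleph0.trans (le_max_right _ _))
  calc #Q = #(Σ E : S, {q // f q = E}) := (mk_congr (Equiv.sigmaFiberEquiv f)).symm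
    _ = Cardinal.sum fun E : S => #{q // f q = E} := mk_sigma _
    _ ≤ Cardinal.sum fun _ : S => ℵ₀ := Cardinal.sum_le_sum _ _ hfin
    _ = #S * ℵ₀ := by rw [sum_const']
    _ ≤ max #(artinSchreierExtensions p K) ℵ₀ :=
        mul_le_of_le (le_max_right _ _) hSle (le_max_right _ _)

end ArtinSchreier

/-! ### Combinatorics of a proper subgroup of small index in a large field -/

section Patterns

open Cardinal

/-- A set of fewer than `#K` multiplicative conditions modulo a subgroup of bounded index has a
nontrivial solution. -/
theorem exists_ne_zero_forall_mul_mem {K : Type u} [Field K] (H : AddSubgroup K) {κ : Cardinal.{u}}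
    (hκ : #(K ⧸ H) ≤ κ) {ι : Type u} (hι : κ ^ #ι < #K) (a : ι → K) :
    ∃ b : K, b ≠ 0 ∧ ∀ i, a i * b ∈ H := by
  let g : K → ι → K ⧸ H := fun b i => ((a i * b : K) : K ⧸ H)
  have hg : ¬ Function.Injective g := by
    intro hinj
    refine (mk_le_of_injective hinj).not_gt ?_
    rw [← power_def]
    exact (power_le_power_right hκ).trans_lt hι
  simp only [Function.Injective, not_forall] at hg
  obtain ⟨b, b', h, hne⟩ := hg
  refine ⟨-b + b', fun h0 => hne (neg_add_eq_zero.1 h0), fun i => ?_⟩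
  have := QuotientAddGroup.eq.1 (congrFun h i)
  rwa [mul_add, mul_neg]

/-- Fix `h ∉ H` and choose `b i` by well-founded recursion as a nonzero solution of the conditions
`(h / b j) * b i ∈ H` for all `j < i`. With `a i = h / b i` the diagonal products all equal `h`. -/
theorem exists_chain {K : Type u} [Field K] {H : AddSubgroup K} (hH : H ≠ ⊤) {κ : Cardinal.{u}}
    (hκ : #(K ⧸ H) ≤ κ) {ι : Type u} [LinearOrder ι] [WellFoundedLT ι] (hι : κ ^ #ι < #K) :
    ∃ a b : ι → K, (∀ i, a i * b i ∉ H) ∧ ∀ j i, j < i → a j * b i ∈ H := by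
  have : ∃ h : K, h ∉ H := by
    by_contra! hn
    exact hH ((AddSubgroup.eq_top_iff' H).2 hn)
  obtain ⟨h, hh⟩ := this
  choose s hs0 hs using fun t : ι → K => exists_ne_zero_forall_mul_mem H hκ hι t
  let b : ι → K := WellFoundedLT.fix fun i IH =>
    s fun j => open Classical in if hj : j < i then h / IH j hj else 0
  have hb : ∀ i, b i = s fun j => open Classical in if j < i then h / b j else 0 := by
    intro i
    have := WellFoundedLT.fix_eq (motive := fun _ : ι => K) (fun i IH =>
      s fun j => open Classical in if hj : j < i then h / IH j hj else 0) i
    simpa only [dite_eq_ite] using this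
  have hb0 : ∀ i, b i ≠ 0 := fun i => by rw [hb]; exact hs0 _
  refine ⟨fun i => h / b i, b, fun i => ?_, fun j i hji => ?_⟩
  · rwa [div_mul_cancel₀ _ (hb0 i)]
  · have := hs (fun j => open Classical in if j < i then h / b j else 0) j
    rw [← hb i, if_pos hji] at this
    exact this

/-- In each of finitely many blocks, two indices of prescribed colour can be selected whose
elements agree modulo the conditions selected in the later blocks. -/
theorem exists_selection {K : Type u} [Field K] (H : AddSubgroup K) {κ : Cardinal.{u}}
    (hκ0 : ℵ₀ ≤ κ) (hκ : #(K ⧸ H) ≤ κ) {X Y : Type u} [Nonempty X] [LinearOrder X] [LinearOrder Y]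
    (a b : Y → X → K) {Z : Set Y} (S : Y → Set X) (hS : ∀ y ∈ Z, κ < #(S y))
    (B : Finset Y) (hB : (B : Set Y) ⊆ Z) :
    ∃ x x' : Y → X, (∀ y ∈ B, x y ∈ S y ∧ x y < x' y) ∧
      ∀ y ∈ B, ∀ z ∈ B, y < z → a z (x z) * (b y (x y) - b y (x' y)) ∈ H := by
  classical
  -- Blocks are added from the top down, so when a block is treated the elements `a z` of the later
  -- blocks are already fixed.
  induction B using Finset.induction_on_min with
  | empty => exact ⟨fun _ => Classical.arbitrary X, fun _ => Classical.arbitrary X, by simp, by simp⟩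
  | insert y B hlt ih =>
    obtain ⟨x, x', hx, hxx⟩ := ih ((Finset.coe_subset.2 (Finset.subset_insert _ _)).trans hB)
    have hyB : y ∉ B := fun h => lt_irrefl _ (hlt y h)
    let g : S y → B → K ⧸ H := fun t z => ((a z (x z) * b y t : K) : K ⧸ H)
    have hg : ¬ Function.Injective g := by
      intro hinj
      refine (mk_le_of_injective hinj).not_gt ?_
      rw [← power_def]
      -- Only finitely many conditions are imposed, so there are at most `κ` classes for more than
      -- `κ` candidates.
      refine lt_of_le_of_lt ((power_le_power_right hκ).trans ?_)
        (hS y (hB (Finset.mem_coe.2 (Finset.mem_insert_self _ _))))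
      rw [mk_fintype, power_natCast]
      exact power_nat_le hκ0
    have : ∃ t t' : S y, g t = g t' ∧ t < t' := by
      simp only [Function.Injective, not_forall] at hg
      obtain ⟨t, t', h, hne⟩ := hg
      rcases lt_or_gt_of_ne hne with hlt | hlt
      · exact ⟨t, t', h, hlt⟩
      · exact ⟨t', t, h.symm, hlt⟩
    obtain ⟨t, t', h, htt⟩ := this
    have hup : ∀ z ∈ B, ∀ s (f : Y → X), Function.update f y s z = f z := fun z hz s f =>
      Function.update_of_ne (ne_of_mem_of_not_mem hz hyB) _ _
    refine ⟨Function.update x y t, Function.update x' y t', ?_, ?_⟩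
    · intro z hz
      rcases Finset.mem_insert.1 hz with rfl | hz
      · simpa using htt
      · rw [hup z hz, hup z hz]
        exact hx z hz
    · intro z hz z' hz' hzz
      rcases Finset.mem_insert.1 hz with rfl | hzB <;>
        rcases Finset.mem_insert.1 hz' with rfl | hzB'
      · exact (lt_irrefl _ hzz).elim
      · rw [hup z' hzB', Function.update_self, Function.update_self, mul_sub, sub_eq_neg_add]
        exact QuotientAddGroup.eq.1 (congrFun h ⟨z', hzB'⟩).symm
      · exact (lt_asymm hzz (hlt z hzB)).elim
      · rw [hup z' hzB', hup z hzB, hup z hzB]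
        exact hxx z hzB z' hzB' hzz

/-- If a proper subgroup `H` of a large field `K` has small index, then the conditions `a * x ∈ H`
shatter arbitrarily large finite sets. -/
theorem exists_pattern {K : Type u} [Field K] {H : AddSubgroup K} (hH : H ≠ ⊤) {κ : Cardinal.{u}}
    (hκ0 : ℵ₀ ≤ κ) (hκ : #(K ⧸ H) ≤ κ) {Φ : Type u} (hΦ : #Φ ≤ κ)
    (hK : κ ^ Order.succ κ < #K) (F : K → K → Φ) :
    ∃ ψ : Φ, ∀ n : ℕ, ∃ (a b : Fin n → K) (C : Set (Fin n) → K),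
      (∀ k, a k * b k ∉ H ∧ F (a k) (b k) = ψ) ∧
      ∀ S l, (l ∉ S → a l * C S ∈ H) ∧ (l ∈ S → a l * (C S - b l) ∈ H) := by
  classical
  let X : Type u := (Order.succ κ).ord.ToType
  have hX : #X = Order.succ κ := by rw [Cardinal.mk_toType, card_ord]
  have hXκ : κ < #X := by rw [hX]; exact Order.lt_succ κ
  have : Nonempty X := mk_ne_zero_iff.1 (pos_of_gt hXκ).ne'
  -- The chain is indexed by `κ⁺` blocks of length `κ⁺`, ordered lexicographically by block first.
  have hι : κ ^ #(X ×ₗ X) < #K := by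
    have : #(X ×ₗ X) = #X := by
      rw [mk_congr (ofLex : X ×ₗ X ≃ X × X), mk_prod, lift_id,
        mul_eq_self (hκ0.trans hXκ.le)]
    rwa [this, hX]
  obtain ⟨a, b, hab, hlt⟩ := exists_chain hH hκ hι
  -- in each block a colour is frequent
  have hcol : ∀ y : X, ∃ ψ : Φ, κ < #{x : X | F (a (toLex (y, x))) (b (toLex (y, x))) = ψ} := by
    intro y
    by_contra! hn
    refine hXκ.not_ge ?_
    calc #X = #(Σ ψ : Φ, {x : X // F (a (toLex (y, x))) (b (toLex (y, x))) = ψ}) :=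
          (mk_congr (Equiv.sigmaFiberEquiv _)).symm
      _ = Cardinal.sum fun ψ : Φ => #{x : X // F (a (toLex (y, x))) (b (toLex (y, x))) = ψ} :=
          mk_sigma _
      _ ≤ Cardinal.sum fun _ : Φ => κ := Cardinal.sum_le_sum _ _ hn
      _ = #Φ * κ := by rw [sum_const']
      _ ≤ κ := mul_le_of_le hκ0 hΦ le_rfl
  choose c hc using hcol
  have hinf : ∃ ψ : Φ, {y : X | c y = ψ}.Infinite := by
    by_contra! hn
    refine hXκ.not_ge ?_
    calc #X = #(Σ ψ : Φ, {y : X // c y = ψ}) := (mk_congr (Equiv.sigmaFiberEquiv _)).symm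
      _ = Cardinal.sum fun ψ : Φ => #{y : X // c y = ψ} := mk_sigma _
      _ ≤ Cardinal.sum fun _ : Φ => ℵ₀ := Cardinal.sum_le_sum _ _ fun ψ =>
          (Cardinal.lt_aleph0_iff_set_finite.2 (hn ψ)).le
      _ = #Φ * ℵ₀ := by rw [sum_const']
      _ ≤ κ := mul_le_of_le hκ0 hΦ hκ0
  obtain ⟨ψ, hψ⟩ := hinf
  refine ⟨ψ, fun n => ?_⟩
  obtain ⟨B, hB, hcard⟩ := hψ.exists_subset_card_eq n
  obtain ⟨x, x', hx, hxx⟩ := exists_selection H hκ0 hκ (fun y x => a (toLex (y, x)))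
    (fun y x => b (toLex (y, x))) (Z := {y : X | c y = ψ})
    (fun y => {x : X | F (a (toLex (y, x))) (b (toLex (y, x))) = ψ})
    (by rintro y rfl; exact hc y) B hB
  let e := B.equivFinOfCardEq hcard
  let y : Fin n → X := fun k => (e.symm k).1
  have hyB : ∀ k, y k ∈ B := fun k => (e.symm k).2
  have hyinj : Function.Injective y := Subtype.val_injective.comp e.symm.injective
  -- `d k` satisfies the conditions of all other blocks: those of later blocks by the selection,
  -- those of earlier blocks because the chain places both terms in `H`. In its own block it acts as
  -- `b` does, since the subtracted term has a larger index and contributes an element of `H`.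
  let d : Fin n → K := fun k => b (toLex (y k, x (y k))) - b (toLex (y k, x' (y k)))
  have hd : ∀ k l, k ≠ l → a (toLex (y l, x (y l))) * d k ∈ H := by
    intro k l hkl
    rcases lt_or_gt_of_ne (hyinj.ne hkl) with h | h
    · exact hxx _ (hyB k) _ (hyB l) h
    · rw [mul_sub]
      exact H.sub_mem (hlt _ _ (Prod.Lex.toLex_lt_toLex.2 (Or.inl h)))
        (hlt _ _ (Prod.Lex.toLex_lt_toLex.2 (Or.inl h)))
  have hdd : ∀ l, a (toLex (y l, x (y l))) * (d l - b (toLex (y l, x (y l)))) ∈ H := by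
    intro l
    have : d l - b (toLex (y l, x (y l))) = - b (toLex (y l, x' (y l))) := by simp [d]
    rw [this, mul_neg]
    exact H.neg_mem (hlt _ _ (Prod.Lex.toLex_lt_toLex.2 (Or.inr ⟨rfl, (hx _ (hyB l)).2⟩)))
  refine ⟨fun k => a (toLex (y k, x (y k))), fun k => b (toLex (y k, x (y k))),
    fun S => ∑ k ∈ Finset.univ.filter (· ∈ S), d k, fun k => ⟨hab _, (hx _ (hyB k)).1⟩,
    fun S l => ⟨fun hl => ?_, fun hl => ?_⟩⟩
  · simp only [Finset.mul_sum]
    refine H.sum_mem fun k hk => hd k l ?_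
    rintro rfl
    exact hl (Finset.mem_filter.1 hk).2
  · have hl' : l ∈ Finset.univ.filter (· ∈ S) := by simpa using hl
    beta_reduce
    rw [← Finset.add_sum_erase _ d hl', add_sub_right_comm, mul_add,
      Finset.mul_sum]
    exact H.add_mem (hdd l) (H.sum_mem fun k hk => hd k l (Finset.ne_of_mem_erase hk))

end Patterns

open FirstOrder FirstOrder.Language

/-! ### Compactness over a structure, and the independence property from finite patterns -/

section Logic

variable {L : FirstOrder.Language.{u, v}}

/-- A formula with parameters in `M` that is satisfied in an elementary extension of `M` is
satisfied in `M`. -/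
theorem exists_realize_of_elementaryEmbedding {M N β : Type*} [L.Structure M] [L.Structure N]
    [Nonempty M] (f : M ↪ₑ[L] N) (φ : L.Formula (M ⊕ β)) {x : β → N}
    (hx : φ.Realize (Sum.elim f x)) : ∃ x' : β → M, φ.Realize (Sum.elim id x') := by
  classical
  -- `β` may be infinite, so only the variables that occur in `φ` are quantified, while the
  -- parameters from `M` stay free.
  let g : φ.freeVarFinset → M ⊕ φ.freeVarFinset := fun s =>
    match s with
    | ⟨Sum.inl m, _⟩ => Sum.inl m
    | ⟨Sum.inr b, h⟩ => Sum.inr ⟨Sum.inr b, h⟩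
  let φ' : L.Formula (M ⊕ φ.freeVarFinset) := φ.restrictFreeVar g
  have key : (φ'.iExs φ.freeVarFinset).Realize (f ∘ (id : M → M)) := by
    rw [Formula.realize_iExs]
    refine ⟨fun s => Sum.elim f x s.1, ?_⟩
    refine (BoundedFormula.realize_restrictFreeVar (Sum.elim f x) ?_).2 hx
    rintro ⟨m | b, h⟩ <;> rfl
  rw [f.map_formula, Formula.realize_iExs] at key
  obtain ⟨y, hy⟩ := key
  refine ⟨fun b => if h : Sum.inr b ∈ φ.freeVarFinset then y ⟨Sum.inr b, h⟩
    else Classical.arbitrary M, ?_⟩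
  refine (BoundedFormula.realize_restrictFreeVar _ ?_).1 hy
  rintro ⟨m | b, h⟩
  · rfl
  · simp [g, h]

theorem realize_comp_elementaryEmbedding {M N N' β : Type*} [L.Structure N] [L.Structure N']
    (f : M → N) (g : N ↪ₑ[L] N') (φ : L.Formula (M ⊕ β)) (x : β → N) :
    φ.Realize (Sum.elim (g ∘ f) (g ∘ x)) ↔ φ.Realize (Sum.elim f x) := by
  rw [← g.map_formula, Sum.comp_elim]

theorem realizations_comp_elementaryEmbedding {M N N' β : Type*} [L.Structure N]
    [L.Structure N'] (f : M → N) (g : N ↪ₑ[L] N') (π : Set (L.Formula (M ⊕ β))) (x : β → N) :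
    g ∘ x ∈ realizations (g ∘ f) π ↔ x ∈ realizations f π := by
  simp only [realizations, Set.mem_ofPred_eq, realize_comp_elementaryEmbedding]

/-- A finite set of formulas over `M` that is realized in an elementary extension of `M` is
realized in `M`. -/
theorem exists_mem_realizations_of_elementaryEmbedding {M N β : Type*} [L.Structure M]
    [L.Structure N] [Nonempty M] (f : M ↪ₑ[L] N) (Δ : Finset (L.Formula (M ⊕ β))) {x : β → N}
    (hx : x ∈ realizations f (Δ : Set (L.Formula (M ⊕ β)))) :
    ∃ x' : β → M, x' ∈ realizations id (Δ : Set (L.Formula (M ⊕ β))) := by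
  obtain ⟨x', hx'⟩ := exists_realize_of_elementaryEmbedding f
    (Formula.iInf fun φ : Δ => φ.1) (x := x) (by
      rw [Formula.realize_iInf]
      exact fun φ => hx _ φ.2)
  rw [Formula.realize_iInf] at hx'
  exact ⟨x', fun φ hφ => hx' ⟨φ, hφ⟩⟩

/-- **Compactness** for partial types over a structure `M`. -/
theorem exists_elementaryEmbedding_realizations {M : Type w} [L.Structure M] [Nonempty M]
    {β : Type (max u v w)} (Γ : Set (L.Formula (M ⊕ β)))
    (h : ∀ Δ : Finset (L.Formula (M ⊕ β)), (Δ : Set (L.Formula (M ⊕ β))) ⊆ Γ →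
      ∃ x : β → M, x ∈ realizations id (Δ : Set (L.Formula (M ⊕ β)))) :
    ∃ (N : Type (max u v w)) (_ : L.Structure N) (f : M ↪ₑ[L] N) (x : β → N),
      x ∈ realizations f Γ := by
  classical
  -- `D` is the elementary diagram of `M`. It makes the interpretation of the constants from `M` an
  -- elementary embedding.
  let D : Set (L.Formula (M ⊕ β)) :=
    {φ | ∃ ψ : L.Formula M, ψ.Realize (id : M → M) ∧ φ = ψ.relabel Sum.inl}
  let T : (L[[M ⊕ β]]).Theory := Formula.equivSentence '' (D ∪ Γ)
  have hT : T.IsSatisfiable := by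
    rw [Theory.isSatisfiable_iff_isFinitelySatisfiable]
    intro T0 hT0
    obtain ⟨Δ, hΔ, rfl⟩ := Finset.subset_set_image_iff.1 hT0
    obtain ⟨x, hx⟩ := h (Δ.filter (· ∈ Γ)) (by
      intro φ hφ
      simpa using (Finset.mem_filter.1 hφ).2)
    let _ := constantsOn.structure (Sum.elim id x : M ⊕ β → M)
    have : M ⊨ ((Δ.image Formula.equivSentence : Finset _) : (L[[M ⊕ β]]).Theory) := by
      refine ⟨fun φ hφ => ?_⟩
      obtain ⟨ψ, hψ, rfl⟩ := Finset.mem_image.1 (Finset.mem_coe.1 hφ)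
      rw [Formula.realize_equivSentence]
      change ψ.Realize (Sum.elim id x)
      rcases hΔ hψ with ⟨χ, hχ, rfl⟩ | hψ'
      · rw [Formula.realize_relabel]
        exact hχ
      · exact hx _ (by simpa using ⟨hψ, hψ'⟩)
    exact Theory.Model.isSatisfiable M
  obtain ⟨N⟩ := hT
  let _ : L.Structure N := (L.lhomWithConstants (M ⊕ β)).reduct N
  have _ : (L.lhomWithConstants (M ⊕ β)).IsExpansionOn N := LHom.isExpansionOn_reduct _ _
  have hN : ∀ φ ∈ D ∪ Γ, φ.Realize fun a => ((L.con a : L[[M ⊕ β]].Constants) : N) := by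
    intro φ hφ
    rw [← Formula.realize_equivSentence]
    exact Theory.realize_sentence_of_mem T (Set.mem_image_of_mem _ hφ)
  have hD : ∀ ψ : L.Formula M, ψ.Realize (id : M → M) →
      ψ.Realize fun m => ((L.con (Sum.inl m : M ⊕ β) : L[[M ⊕ β]].Constants) : N) := by
    intro ψ hψ
    have := hN _ (Or.inl ⟨ψ, hψ, rfl⟩)
    rwa [Formula.realize_relabel] at this
  refine ⟨N, inferInstance,
    ⟨fun m => ((L.con (Sum.inl m : M ⊕ β) : L[[M ⊕ β]].Constants) : N), ?_⟩,
    fun b => ((L.con (Sum.inr b : M ⊕ β) : L[[M ⊕ β]].Constants) : N), ?_⟩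
  · intro n φ y
    have h1 : ∀ φ : L.Formula (Fin n), φ.Realize y →
        φ.Realize fun i => ((L.con (Sum.inl (y i) : M ⊕ β) : L[[M ⊕ β]].Constants) : N) := by
      intro φ hφ
      have := hD (φ.relabel y) (by rwa [Formula.realize_relabel])
      rwa [Formula.realize_relabel] at this
    refine ⟨fun hφ => ?_, h1 φ⟩
    by_contra hn
    exact (Formula.realize_not.1 (h1 φ.not (Formula.realize_not.2 hn))) hφ
  · intro φ hφ
    have := hN φ (Or.inr hφ)
    convert this using 1
    ext (m | b) <;> rfl

theorem mem_realizations_relabel {M M' N β γ : Type*} [L.Structure N] (f : M' → N) (x : γ → N)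
    (ρ : M ⊕ β → M' ⊕ γ) (Γ : Set (L.Formula (M ⊕ β))) :
    x ∈ realizations f (Formula.relabel ρ '' Γ) ↔ ∀ φ ∈ Γ, φ.Realize (Sum.elim f x ∘ ρ) := by
  simp only [realizations, Set.mem_ofPred_eq, Set.forall_mem_image, Formula.realize_relabel]

theorem mem_realizations_relabel_map {M N β γ : Type*} [L.Structure N] (f : M → N) (x : γ → N)
    (ρ : β → γ) (Γ : Set (L.Formula (M ⊕ β))) :
    x ∈ realizations f (Formula.relabel (Sum.map id ρ) '' Γ) ↔ x ∘ ρ ∈ realizations f Γ := by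
  rw [mem_realizations_relabel]
  have : Sum.elim f x ∘ Sum.map id ρ = Sum.elim f (x ∘ ρ) := by
    ext (m | b) <;> rfl
  rw [this]
  rfl

theorem mem_realizations_union {M N β : Type*} [L.Structure N] (f : M → N) (x : β → N)
    (Γ Γ' : Set (L.Formula (M ⊕ β))) :
    x ∈ realizations f (Γ ∪ Γ') ↔ x ∈ realizations f Γ ∧ x ∈ realizations f Γ' := by
  simp only [realizations, Set.mem_ofPred_eq, Set.mem_union, or_imp, forall_and]

theorem mem_realizations_iUnion {M N β : Type*} {ι : Sort*} [L.Structure N] (f : M → N) (x : β → N)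
    (Γ : ι → Set (L.Formula (M ⊕ β))) :
    x ∈ realizations f (⋃ i, Γ i) ↔ ∀ i, x ∈ realizations f (Γ i) := by
  simp only [realizations, Set.mem_ofPred_eq, Set.mem_iUnion]
  exact ⟨fun h i φ hφ => h φ ⟨i, hφ⟩, fun h φ ⟨i, hφ⟩ => h i φ hφ⟩

theorem realizations_mono {M N β : Type*} [L.Structure N] (f : M → N)
    {Γ Γ' : Set (L.Formula (M ⊕ β))} (h : Γ ⊆ Γ') : realizations f Γ' ⊆ realizations f Γ :=
  fun _ hx φ hφ => hx φ (h hφ)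

/-- Compactness for partial types over `M` that are inconsistent in all elementary extensions
of `M`. -/
theorem exists_finset_realizations_eq_empty {M : Type w} [L.Structure M] [Nonempty M]
    {β : Type} (Γ Γ' : Set (L.Formula (M ⊕ β)))
    (h : ∀ (N : Type (max u v w)) [L.Structure N] (f : M ↪ₑ[L] N) (x : β → N),
      x ∈ realizations f Γ → x ∉ realizations f Γ') :
    ∃ Δ : Finset (L.Formula (M ⊕ β)), (Δ : Set (L.Formula (M ⊕ β))) ⊆ Γ ∧
      ∀ (N : Type (max u v w)) [L.Structure N] (f : M ↪ₑ[L] N) (x : β → N),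
        x ∈ realizations f (Δ : Set (L.Formula (M ⊕ β))) → x ∉ realizations f Γ' := by
  classical
  by_contra! hn
  let ρ : M ⊕ β → M ⊕ ULift.{max u v w} β := Sum.map id ULift.up
  obtain ⟨N, _, f, x, hx⟩ := exists_elementaryEmbedding_realizations
    (Formula.relabel ρ '' (Γ ∪ Γ')) (by
      intro Δ hΔ
      obtain ⟨Δ, hΔΓ, rfl⟩ := Finset.subset_set_image_iff.1 hΔ
      obtain ⟨N, _, f, x, hx, hx'⟩ := hn (Δ.filter (· ∈ Γ)) (by
        intro φ hφ
        simpa using (Finset.mem_filter.1 hφ).2)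
      obtain ⟨y, hy⟩ := exists_mem_realizations_of_elementaryEmbedding f Δ (x := x) (by
        intro φ hφ
        rcases hΔΓ hφ with h1 | h1
        · exact hx _ (by simpa using ⟨hφ, h1⟩)
        · exact hx' _ h1)
      refine ⟨y ∘ ULift.down, ?_⟩
      rw [Finset.coe_image, mem_realizations_relabel_map]
      exact hy)
  rw [mem_realizations_relabel_map, mem_realizations_union] at hx
  exact h N f _ hx.1 hx.2

/-- The formula expressing that two finite tuples of variables are different. -/
noncomputable def neFormula {β W : Type*} [Finite W] (s t : W → β) : L.Formula β :=
  (Formula.iInf fun w => (Term.var (s w)).equal (Term.var (t w))).not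

theorem realize_neFormula {β W N : Type*} [L.Structure N] [Finite W] (s t : W → β) (x : β → N) :
    (neFormula (L := L) s t).Realize x ↔ x ∘ s ≠ x ∘ t := by
  rw [neFormula, Formula.realize_not, Formula.realize_iInf]
  simp [funext_iff]

/-- Existential quantification of a finite conjunction. -/
noncomputable def exConj {α X W : Type*} [Finite W] (Δ : Finset (L.Formula (α ⊕ (X ⊕ W)))) :
    L.Formula (α ⊕ X) :=
  ((Formula.iInf fun φ : Δ => φ.1).relabel (Equiv.sumAssoc α X W).symm).iExs W

theorem realize_exConj {α X W N : Type*} [L.Structure N] [Finite W]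
    (Δ : Finset (L.Formula (α ⊕ (X ⊕ W)))) (f : α → N) (x : X → N) :
    (exConj Δ).Realize (Sum.elim f x) ↔
      ∃ y : W → N, Sum.elim x y ∈ realizations f (Δ : Set (L.Formula (α ⊕ (X ⊕ W)))) := by
  rw [exConj, Formula.realize_iExs]
  refine exists_congr fun y => ?_
  rw [Formula.realize_relabel, Formula.realize_iInf]
  have : Sum.elim (Sum.elim f x) y ∘ (Equiv.sumAssoc α X W).symm = Sum.elim f (Sum.elim x y) := by
    ext (a | a | a) <;> rfl
  rw [this]
  exact ⟨fun h φ hφ => h ⟨φ, hφ⟩, fun h φ => h _ φ.2⟩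

/-- Arbitrarily long finite patterns of the independence property give the independence property,
also for a formula with parameters. -/
theorem hasIP_of_finite_patterns {T : L.Theory} {M N A B : Type*} [L.Structure N]
    [Nonempty N] [N ⊨ T] [Finite A] [Finite B] (f : M → N) (φ : L.Formula (M ⊕ (A ⊕ B)))
    (h : ∀ n : ℕ, ∃ (a : Fin n → A → N) (b : Set (Fin n) → B → N), ∀ i I,
      φ.Realize (Sum.elim f (Sum.elim (a i) (b I))) ↔ i ∈ I) : HasIP T := by
  classical
  let F := φ.freeVarFinset
  obtain ⟨m, ⟨eA⟩⟩ := Finite.exists_equiv_fin A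
  obtain ⟨n, ⟨eB⟩⟩ := Finite.exists_equiv_fin (B ⊕ F)
  -- The parameters that occur in `φ` become extra coordinates of the second tuple, because the
  -- definition of IP allows no parameters.
  let g : F → Fin m ⊕ Fin n := fun s =>
    match s with
    | ⟨Sum.inl c, hc⟩ => Sum.inr (eB (Sum.inr ⟨Sum.inl c, hc⟩))
    | ⟨Sum.inr (Sum.inl a), _⟩ => Sum.inl (eA a)
    | ⟨Sum.inr (Sum.inr b), _⟩ => Sum.inr (eB (Sum.inl b))
  let φ' : L.Formula (Fin m ⊕ Fin n) := φ.restrictFreeVar g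
  let par : F → N := fun s => Sum.elim f (fun _ => Classical.arbitrary N) s.1
  have hφ' : ∀ (a : A → N) (b : B → N),
      φ'.Realize (Sum.elim (a ∘ eA.symm) (Sum.elim b par ∘ eB.symm)) ↔
        φ.Realize (Sum.elim f (Sum.elim a b)) := by
    intro a b
    refine BoundedFormula.realize_restrictFreeVar _ ?_
    rintro ⟨c | a | b, hc⟩ <;> simp [g, par]
  let κ := (ℕ × Fin m) ⊕ (Set ℕ × Fin n)
  let S : ℕ → Set ℕ → L.Formula κ := fun i I =>
    (if i ∈ I then φ' else φ'.not).relabel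
      (Sum.map (fun k => (i, k)) (fun k => (I, k)))
  let T' : ℕ → (L[[κ]]).Theory := fun l =>
    (L.lhomWithConstants κ).onTheory T ∪
      {σ | ∃ i I, i < l ∧ σ = Formula.equivSentence (S i I)}
  have hsat : Theory.IsSatisfiable (⋃ l, T' l) := by
    rw [Theory.isSatisfiable_directed_union_iff]
    · intro l
      obtain ⟨a, b, hab⟩ := h l
      -- Only rows below `l` matter, so `I` is represented by the witness for its trace on `Fin l`,
      -- and the remaining rows are arbitrary.
      let c : κ → N := Sum.elim
        (fun q => if hq : q.1 < l then (a ⟨q.1, hq⟩ ∘ eA.symm) q.2 else Classical.arbitrary N)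
        (fun q => (Sum.elim (b {i | (i : ℕ) ∈ q.1}) par ∘ eB.symm) q.2)
      let _ := constantsOn.structure c
      have h1 : N ⊨ (L.lhomWithConstants κ).onTheory T := by
        rw [LHom.onTheory_model]
        infer_instance
      have h2 : N ⊨ ({σ | ∃ i I, i < l ∧ σ = Formula.equivSentence (S i I)} : (L[[κ]]).Theory) := by
        refine ⟨?_⟩
        rintro σ ⟨i, I, hi, rfl⟩
        rw [Formula.realize_equivSentence]
        change (S i I).Realize c
        have hc : c ∘ (Sum.map (fun k => (i, k)) (fun k => (I, k))) =
            Sum.elim (a ⟨i, hi⟩ ∘ eA.symm) (Sum.elim (b {i | (i : ℕ) ∈ I}) par ∘ eB.symm) := by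
          ext (k | k) <;> simp [c, hi]
        simp only [S]
        rw [Formula.realize_relabel, hc]
        have := (hφ' (a ⟨i, hi⟩) (b {i | (i : ℕ) ∈ I})).trans (hab _ _)
        split_ifs with hiI
        · exact this.2 hiI
        · rw [Formula.realize_not, this]
          exact hiI
      have _ := h1.union h2
      exact Theory.Model.isSatisfiable N
    · refine directed_of_isDirected_le fun l l' hl => Set.union_subset_union_right _ ?_
      rintro σ ⟨i, I, hi, rfl⟩
      exact ⟨i, I, hi.trans_le hl, rfl⟩
  obtain ⟨P⟩ := hsat
  let _ : L.Structure P := (L.lhomWithConstants κ).reduct P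
  have _ : (L.lhomWithConstants κ).IsExpansionOn P := LHom.isExpansionOn_reduct _ _
  have hPT : P ⊨ T := by
    rw [← LHom.onTheory_model (L.lhomWithConstants κ)]
    exact P.is_model.mono ((Set.subset_union_left).trans (Set.subset_iUnion T' 0))
  refine ⟨m, n, φ', Theory.ModelType.of T P, fun i k => ((L.con (Sum.inl (i, k) : κ) : L[[κ]].Constants) : P),
    fun I k => ((L.con (Sum.inr (I, k) : κ) : L[[κ]].Constants) : P), fun i I => ?_⟩
  have hS : (S i I).Realize fun q => ((L.con q : L[[κ]].Constants) : P) := by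
    rw [← Formula.realize_equivSentence]
    exact Theory.realize_sentence_of_mem (⋃ l, T' l)
      (Set.mem_iUnion.2 ⟨i + 1, Or.inr ⟨i, I, Nat.lt_succ_self i, rfl⟩⟩)
  simp only [S] at hS
  rw [Formula.realize_relabel] at hS
  have he : (fun q => ((L.con q : L[[κ]].Constants) : P)) ∘
      (Sum.map (fun k => (i, k)) (fun k => (I, k))) =
      Sum.elim (fun k => ((L.con (Sum.inl (i, k) : κ) : L[[κ]].Constants) : P))
        (fun k => ((L.con (Sum.inr (I, k) : κ) : L[[κ]].Constants) : P)) := by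
    ext (k | k) <;> rfl
  rw [he] at hS
  split_ifs at hS with hiI
  · exact iff_of_true hS hiI
  · exact iff_of_false (Formula.realize_not.1 hS) hiI

end Logic

open FirstOrder FirstOrder.Language

/-! ### Equations in a type-definable field as partial types -/

namespace TypeDefinableField

variable {L : FirstOrder.Language.{u, v}} {M : Type w} [L.Structure M]

section Points

variable (K : TypeDefinableField L M) {N : Type (max u v w)} [L.Structure N] (f : M ↪ₑ[L] N)

/-- The tuple underlying a point. -/
def toTuple {K : TypeDefinableField L M} {f : M ↪ₑ[L] N} (x : K.Points f) : Fin K.arity → N :=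
  Subtype.val (p := (· ∈ realizations f K.carrier)) x

theorem toTuple_mem {K : TypeDefinableField L M} {f : M ↪ₑ[L] N} (x : K.Points f) :
    toTuple x ∈ realizations f K.carrier :=
  Subtype.property (p := (· ∈ realizations f K.carrier)) x

theorem toTuple_injective {K : TypeDefinableField L M} {f : M ↪ₑ[L] N} :
    Function.Injective (toTuple : K.Points f → Fin K.arity → N) :=
  Subtype.val_injective

theorem exists_toTuple_eq {x : Fin K.arity → N} (hx : x ∈ realizations f K.carrier) :
    ∃ y : K.Points f, toTuple y = x :=
  ⟨(⟨x, hx⟩ : {x // x ∈ realizations f K.carrier}), rfl⟩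

theorem add_eq_iff {K : TypeDefinableField L M} {f : M ↪ₑ[L] N} (x y z : K.Points f) :
    x + y = z ↔
      Sum.elim (toTuple x) (Sum.elim (toTuple y) (toTuple z)) ∈ realizations f K.add :=
  ((K.isField N f).choose_spec x y z).1

theorem mul_eq_iff {K : TypeDefinableField L M} {f : M ↪ₑ[L] N} (x y z : K.Points f) :
    x * y = z ↔
      Sum.elim (toTuple x) (Sum.elim (toTuple y) (toTuple z)) ∈ realizations f K.mul :=
  ((K.isField N f).choose_spec x y z).2

end Points

/-- The partial type of the solutions of a system of equations `x + y = z` and `x * y = z` between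
elements of `K`. The unknown `s` is represented by the tuple `t s` of variables. -/
def systemType (K : TypeDefinableField L M) {V β : Type*} (t : V → Fin K.arity → β)
    (A B : Set (V × V × V)) : Set (L.Formula (M ⊕ β)) :=
  (⋃ s, Formula.relabel (Sum.map id (t s)) '' K.carrier) ∪
    ((⋃ s ∈ A, Formula.relabel
        (Sum.map id (Sum.elim (t s.1) (Sum.elim (t s.2.1) (t s.2.2)))) '' K.add) ∪
      (⋃ s ∈ B, Formula.relabel
        (Sum.map id (Sum.elim (t s.1) (Sum.elim (t s.2.1) (t s.2.2)))) '' K.mul))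

theorem mem_realizations_systemType (K : TypeDefinableField L M) {V β : Type*}
    (t : V → Fin K.arity → β) (A B : Set (V × V × V)) {N : Type (max u v w)} [L.Structure N]
    (f : M ↪ₑ[L] N) (x : β → N) :
    x ∈ realizations f (K.systemType t A B) ↔ ∃ e : V → K.Points f,
      (∀ s, toTuple (e s) = x ∘ t s) ∧ (∀ s ∈ A, e s.1 + e s.2.1 = e s.2.2) ∧
        ∀ s ∈ B, e s.1 * e s.2.1 = e s.2.2 := by
  simp only [systemType, mem_realizations_union, mem_realizations_iUnion,
    mem_realizations_relabel_map, Sum.comp_elim]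
  constructor
  · rintro ⟨h1, h2, h3⟩
    choose e he using fun s => K.exists_toTuple_eq f (h1 s)
    refine ⟨e, he, fun s hs => ?_, fun s hs => ?_⟩
    · rw [add_eq_iff, he, he, he]
      exact h2 s hs
    · rw [mul_eq_iff, he, he, he]
      exact h3 s hs
  · rintro ⟨e, he, h2, h3⟩
    refine ⟨fun s => ?_, fun s hs => ?_, fun s hs => ?_⟩
    · rw [← he]
      exact toTuple_mem _
    · rw [← he, ← he, ← he, ← add_eq_iff]
      exact h2 s hs
    · rw [← he, ← he, ← he, ← mul_eq_iff]
      exact h3 s hs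

/-- The variables for the witnesses `y, y ^ 2, …, y ^ p, y ^ p - y` of an equation
`a * b = y ^ p - y`. -/
abbrev Wit (K : TypeDefinableField L M) (p : ℕ) : Type :=
  Fin (p + 1) × Fin K.arity

/-- The partial type of the equation `a * b = y ^ p - y`. -/
def artinSchreierType (K : TypeDefinableField L M) (p : ℕ) :
    Set (L.Formula (M ⊕ ((Fin K.arity ⊕ Fin K.arity) ⊕ K.Wit p))) :=
  K.systemType (V := Bool ⊕ Fin (p + 1))
    (Sum.elim (fun s i => Sum.inl (cond s (Sum.inl i) (Sum.inr i))) fun s i => Sum.inr (s, i))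
    -- The unknown with index `i < p` stands for `y ^ (i + 1)` and the last one for `y ^ p - y`. The
    -- single additive equation is `(y ^ p - y) + y = y ^ p`, with `y ^ p` at index `p - 1`.
    {s | ∃ j : Fin (p + 1), (j : ℕ) + 1 = p ∧ s = (Sum.inr (Fin.last p), Sum.inr 0, Sum.inr j)}
    ({s | ∃ i j : Fin (p + 1), (j : ℕ) = i + 1 ∧ (j : ℕ) < p ∧
        s = (Sum.inr 0, Sum.inr i, Sum.inr j)} ∪
      {(Sum.inl true, Sum.inl false, Sum.inr (Fin.last p))})

section Field

variable {K : TypeDefinableField L M} {p : ℕ} {N : Type (max u v w)} [L.Structure N]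
  {f : M ↪ₑ[L] N}

/-- The witnesses for the equation `a * b = y ^ p - y` given by `y`. -/
noncomputable def witness (p : ℕ) (y : K.Points f) : K.Wit p → N := fun s =>
  toTuple (if s.1 = Fin.last p then y ^ p - y else y ^ ((s.1 : ℕ) + 1)) s.2

theorem mem_realizations_artinSchreierType (hp : p.Prime)
    (x : (Fin K.arity ⊕ Fin K.arity) ⊕ K.Wit p → N) :
    x ∈ realizations f (K.artinSchreierType p) ↔ ∃ a b y : K.Points f, y ^ p - y = a * b ∧
      x = Sum.elim (Sum.elim (toTuple a) (toTuple b)) (witness p y) := by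
  have hp1 := hp.one_lt
  rw [artinSchreierType, mem_realizations_systemType]
  constructor
  · rintro ⟨e, he, hA, hB⟩
    have hpow : ∀ i : ℕ, ∀ hi : i < p,
        e (Sum.inr ⟨i, hi.trans p.lt_succ_self⟩) = e (Sum.inr 0) ^ (i + 1) := by
      intro i
      induction i with
      | zero => intro _; rw [zero_add, pow_one]; rfl
      | succ i ih =>
        intro hi
        have := hB (Sum.inr 0, Sum.inr ⟨i, by omega⟩, Sum.inr ⟨i + 1, by omega⟩)
          (Or.inl ⟨_, _, rfl, hi, rfl⟩)
        rw [← this]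
        simp only
        rw [ih (by omega), ← pow_succ']
    have hlast : e (Sum.inr (Fin.last p)) = e (Sum.inr 0) ^ p - e (Sum.inr 0) := by
      have := hA (Sum.inr (Fin.last p), Sum.inr 0, Sum.inr ⟨p - 1, by omega⟩)
        ⟨_, Nat.sub_add_cancel hp1.le, rfl⟩
      simp only at this
      rw [hpow (p - 1) (by omega), Nat.sub_add_cancel hp1.le] at this
      exact eq_sub_of_add_eq this
    refine ⟨e (Sum.inl true), e (Sum.inl false), e (Sum.inr 0), ?_, ?_⟩
    · rw [← hlast]
      exact (hB _ (Or.inr rfl)).symm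
    · ext ((i | i) | ⟨s, i⟩)
      · exact (congrFun (he (Sum.inl true)) i).symm
      · exact (congrFun (he (Sum.inl false)) i).symm
      · have h1 := (congrFun (he (Sum.inr s)) i).symm
        refine h1.trans ?_
        simp only [Sum.elim_inr, witness]
        congr 1
        split_ifs with hs
        · rw [hs, hlast]
        · rw [← hpow s (by
            have := s.2
            have : (s : ℕ) ≠ p := fun h => hs (Fin.ext h)
            omega)]
  · rintro ⟨a, b, y, hy, rfl⟩
    refine ⟨Sum.elim (fun s => cond s a b)
      (fun s => if s = Fin.last p then y ^ p - y else y ^ ((s : ℕ) + 1)), ?_, ?_, ?_⟩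
    · rintro ((_ | _) | s) <;> rfl
    · have h0 : (0 : Fin (p + 1)) ≠ Fin.last p := fun h => hp.ne_zero (congrArg Fin.val h).symm
      rintro _ ⟨j, hj, rfl⟩
      have hj' : j ≠ Fin.last p := by rintro rfl; simp at hj
      simp [hj', h0, hj]
    · have h0 : (0 : Fin (p + 1)) ≠ Fin.last p := fun h => hp.ne_zero (congrArg Fin.val h).symm
      rintro _ (⟨i, j, hij, hj, rfl⟩ | rfl)
      · have hj' : j ≠ Fin.last p := by rintro rfl; simp at hj
        have hi' : i ≠ Fin.last p := by rintro rfl; simp at hij; omega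
        simp [hj', h0, hi', hij, pow_succ']
      · simp [hy]

/-- The whole witness tuple is determined by `y`. Bounding the number of roots thus bounds the
number of realizations over fixed `a` and `b`. -/
theorem mem_realizations_artinSchreierType' (hp : p.Prime) (a b : K.Points f) (z : K.Wit p → N) :
    Sum.elim (Sum.elim (toTuple a) (toTuple b)) z ∈ realizations f (K.artinSchreierType p) ↔
      ∃ y : K.Points f, y ^ p - y = a * b ∧ z = witness p y := by
  rw [mem_realizations_artinSchreierType hp]
  constructor
  · rintro ⟨a', b', y, hy, h⟩
    obtain rfl : a = a' :=
      toTuple_injective (funext fun i => congrFun h (Sum.inl (Sum.inl i)))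
    obtain rfl : b = b' :=
      toTuple_injective (funext fun i => congrFun h (Sum.inl (Sum.inr i)))
    exact ⟨y, hy, funext fun s => congrFun h (Sum.inr s)⟩
  · rintro ⟨y, hy, rfl⟩
    exact ⟨a, b, y, hy, rfl⟩

/-- If `a * b` is not of the form `y ^ p - y`, then this is witnessed by finitely many formulas. -/
theorem exists_finset_not_realize_exConj [Nonempty M] (hp : p.Prime) (a b : K.Points f)
    (hab : ∀ y : K.Points f, y ^ p - y ≠ a * b) :
    ∃ ψ : Finset (L.Formula (M ⊕ ((Fin K.arity ⊕ Fin K.arity) ⊕ K.Wit p))),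
      (ψ : Set _) ⊆ K.artinSchreierType p ∧
        ¬ (exConj ψ).Realize (Sum.elim f (Sum.elim (toTuple a) (toTuple b))) := by
  classical
  by_contra! hn
  have hfail : ∀ z : K.Wit p → N, ∃ φ ∈ K.artinSchreierType p,
      ¬ φ.Realize (Sum.elim f (Sum.elim (Sum.elim (toTuple a) (toTuple b)) z)) := by
    intro z
    by_contra! hz
    obtain ⟨y, hy, -⟩ := (mem_realizations_artinSchreierType' hp a b z).1 hz
    exact hab y hy
  choose φ hφ hφz using hfail
  let Sol (ψ : Finset (L.Formula (M ⊕ ((Fin K.arity ⊕ Fin K.arity) ⊕ K.Wit p)))) :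
      Set (K.Wit p → N) :=
    {z | Sum.elim (Sum.elim (toTuple a) (toTuple b)) z ∈
      realizations f (ψ : Set (L.Formula (M ⊕ ((Fin K.arity ⊕ Fin K.arity) ⊕ K.Wit p))))}
  -- If a finite part had only finitely many solutions, adding for each of them a formula of the
  -- type that it violates would leave a finite part without solutions.
  have hSol : ∀ ψ : Finset (L.Formula (M ⊕ ((Fin K.arity ⊕ Fin K.arity) ⊕ K.Wit p))),
      (ψ : Set _) ⊆ K.artinSchreierType p → (Sol ψ).Infinite := by
    intro ψ hψ hfin
    obtain ⟨z, hz⟩ := (realize_exConj _ f _).1 (hn (ψ ∪ hfin.toFinset.image φ) (by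
      intro χ hχ
      rcases Finset.mem_union.1 (Finset.mem_coe.1 hχ) with h | h
      · exact hψ h
      · obtain ⟨z, -, rfl⟩ := Finset.mem_image.1 h
        exact hφ z))
    have hzS : z ∈ Sol ψ := realizations_mono _ (by simp) hz
    exact hφz z (hz _ (Finset.mem_coe.2 (Finset.mem_union_right _
      (Finset.mem_image_of_mem _ (hfin.mem_toFinset.2 hzS)))))
  let ρ (j : Fin (p + 1)) : M ⊕ ((Fin K.arity ⊕ Fin K.arity) ⊕ K.Wit p) →
      N ⊕ (Fin (p + 1) × K.Wit p) :=
    Sum.elim (fun m => Sum.inl (f m)) (Sum.elim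
      (fun s => Sum.inl (Sum.elim (toTuple a) (toTuple b) s)) fun s => Sum.inr (j, s))
  have hρ : ∀ (N' : Type (max u v w)) (g : N → N') (x : Fin (p + 1) × K.Wit p → N') (j),
      Sum.elim g x ∘ ρ j = Sum.elim (g ∘ f)
        (Sum.elim (g ∘ Sum.elim (toTuple a) (toTuple b)) fun s => x (j, s)) := by
    intro N' g x j
    ext (m | s | s) <;> rfl
  let D : Set (L.Formula (N ⊕ (Fin (p + 1) × K.Wit p))) :=
    {χ | ∃ i j : Fin (p + 1), i ≠ j ∧
      χ = neFormula (fun s => Sum.inr (i, s)) (fun s => Sum.inr (j, s))}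
  have _ : Nonempty N := f.elementarilyEquivalent.nonempty_iff.1 inferInstance
  -- In no elementary extension of `N` can `p + 1` distinct tuples realize the full type, since `y ^
  -- p - y = a * b` has at most `p` roots. By compactness a finite part already excludes `p + 1`
  -- distinct solutions, against their infinitude.
  obtain ⟨Δ, hΔ, hΔN⟩ := exists_finset_realizations_eq_empty.{u, v, max u v w} (M := N)
    (⋃ j, Formula.relabel (ρ j) '' K.artinSchreierType p) D (by
      intro N' _ g x hx hD
      simp only [mem_realizations_iUnion, mem_realizations_relabel, hρ, Sum.comp_elim] at hx
      have hmap : ∀ x : K.Points f, ∃ x' : K.Points (g.comp f), toTuple x' = g ∘ toTuple x :=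
        fun x => K.exists_toTuple_eq (g.comp f)
          ((realizations_comp_elementaryEmbedding f g K.carrier _).2 (toTuple_mem x))
      obtain ⟨a', ha'⟩ := hmap a
      obtain ⟨b', hb'⟩ := hmap b
      rw [← ha', ← hb'] at hx
      choose y hy hxy using fun j =>
        (mem_realizations_artinSchreierType' (f := g.comp f) hp a' b' _).1 (hx j)
      have hinj : Function.Injective y := by
        intro i j hij
        by_contra hne
        refine (realize_neFormula _ _ _).1 (hD _ ⟨i, j, hne, rfl⟩) ?_
        change (fun s => x (i, s)) = fun s => x (j, s)
        rw [hxy, hxy, hij]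
      exact not_injective_of_pow_sub_eq hp.one_lt hy hinj)
  choose! s hs using fun χ (hχ : χ ∈ Δ) => Set.mem_iUnion.1 (hΔ hχ)
  choose! t ht hts using hs
  obtain ⟨Z, hZ⟩ := (hSol (Δ.image t) (by
    intro χ hχ
    obtain ⟨χ', hχ', rfl⟩ := Finset.mem_image.1 (Finset.mem_coe.1 hχ)
    exact ht χ' hχ')).exists_subset_card_eq (p + 1)
  let e := Z.equivFinOfCardEq hZ.2
  refine hΔN N (ElementaryEmbedding.refl L N) (fun q => (e.symm q.1).1 q.2) ?_ ?_
  · intro χ hχ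
    rw [← hts χ hχ, Formula.realize_relabel, hρ]
    exact hZ.1 (e.symm (s χ)).2 _ (Finset.mem_coe.2 (Finset.mem_image_of_mem _ hχ))
  · rintro χ ⟨i, j, hij, rfl⟩
    rw [realize_neFormula]
    intro h
    exact hij (e.symm.injective (Subtype.ext h))

/-- If `a * c` and `a * (c - b)` are both of the form `y ^ p - y`, then so is `a * b` by additivity,
and `exConj ψ` holds at `(a, b)`. Hence the type of `a * c = y ^ p - y` is inconsistent with the
second situation, and `θ` is a finite part of that type that already shows this. -/
theorem exists_separating_formula [Nonempty M] (hp : p.Prime) (hchar : K.HasChar p)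
    (ψ : Finset (L.Formula (M ⊕ ((Fin K.arity ⊕ Fin K.arity) ⊕ K.Wit p))))
    (hψ : (ψ : Set _) ⊆ K.artinSchreierType p) :
    ∃ θ : L.Formula (M ⊕ (Fin K.arity ⊕ Fin K.arity)),
      ∀ (N : Type (max u v w)) [L.Structure N] (f : M ↪ₑ[L] N) (a c : K.Points f),
        ((∃ y, y ^ p - y = a * c) →
          θ.Realize (Sum.elim f (Sum.elim (toTuple a) (toTuple c)))) ∧
        ∀ b : K.Points f, (∃ y, y ^ p - y = a * (c - b)) →
          ¬ (exConj ψ).Realize (Sum.elim f (Sum.elim (toTuple a) (toTuple b))) →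
          ¬ θ.Realize (Sum.elim f (Sum.elim (toTuple a) (toTuple c))) := by
  let ρ (c : Fin 4) (s : Bool) : (Fin K.arity ⊕ Fin K.arity) ⊕ K.Wit p →
      (Fin 4 × Fin K.arity) ⊕ (Bool × K.Wit p) :=
    Sum.map (Sum.elim (fun i => (0, i)) fun i => (c, i)) fun i => (s, i)
  let τ : Fin K.arity ⊕ Fin K.arity → (Fin 4 × Fin K.arity) ⊕ (Bool × K.Wit p) :=
    Sum.elim (fun i => Sum.inl (0, i)) fun i => Sum.inl (3, i)
  -- the variables are `a`, `c`, `d`, `b` with `b + d = c`, and witnesses for `a * c` and `a * d`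
  let Γ' : Set (L.Formula (M ⊕ ((Fin 4 × Fin K.arity) ⊕ (Bool × K.Wit p)))) :=
    Formula.relabel (Sum.map id (ρ 2 false)) '' K.artinSchreierType p ∪
      (K.systemType (fun (j : Fin 4) i => Sum.inl (j, i)) {(3, 2, 1)} ∅ ∪
        {(exConj ψ).not.relabel (Sum.map id τ)})
  have hΓ' : ∀ (N : Type (max u v w)) [L.Structure N] (f : M ↪ₑ[L] N)
      (x : (Fin 4 × Fin K.arity) ⊕ (Bool × K.Wit p) → N),
      x ∈ realizations f Γ' ↔ x ∘ ρ 2 false ∈ realizations f (K.artinSchreierType p) ∧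
        x ∈ realizations f (K.systemType (fun (j : Fin 4) i => Sum.inl (j, i)) {(3, 2, 1)} ∅) ∧
        ¬ (exConj ψ).Realize (Sum.elim f (x ∘ τ)) := by
    intro N _ f x
    rw [mem_realizations_union, mem_realizations_union, mem_realizations_relabel_map]
    have : Sum.elim f x ∘ Sum.map id τ = Sum.elim f (x ∘ τ) := by
      ext (m | i) <;> rfl
    simp only [realizations, Set.mem_ofPred_eq, Set.mem_singleton_iff, forall_eq,
      Formula.realize_relabel, Formula.realize_not, this]
  obtain ⟨Δ, hΔ, hΔN⟩ := exists_finset_realizations_eq_empty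
    (Formula.relabel (Sum.map id (ρ 1 true)) '' K.artinSchreierType p) Γ' (by
      intro N _ f x hx hx'
      have _ := hchar N f
      have _ : Fact p.Prime := ⟨hp⟩
      obtain ⟨hd, hsys, hnot⟩ := (hΓ' N f x).1 hx'
      obtain ⟨e, he, hadd, -⟩ := (K.mem_realizations_systemType _ _ _ f x).1 hsys
      have hadd' : e 3 + e 2 = e 1 := hadd (3, 2, 1) rfl
      rw [mem_realizations_relabel_map] at hx
      have hsplit : ∀ c s, x ∘ ρ c s = Sum.elim (Sum.elim (toTuple (e 0)) (toTuple (e c)))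
          fun i => x (Sum.inr (s, i)) := by
        intro c s
        rw [he, he]
        ext ((i | i) | i) <;> rfl
      rw [hsplit, mem_realizations_artinSchreierType' hp] at hx hd
      obtain ⟨y, hy, -⟩ := hx
      obtain ⟨z, hz, -⟩ := hd
      have hτ : x ∘ τ = Sum.elim (toTuple (e 0)) (toTuple (e 3)) := by
        rw [he, he]
        ext (i | i) <;> rfl
      refine hnot ?_
      rw [hτ, realize_exConj]
      refine ⟨_, realizations_mono _ hψ
        ((mem_realizations_artinSchreierType' hp (e 0) (e 3) _).2 ⟨y - z, ?_, rfl⟩)⟩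
      rw [sub_pow_char]
      linear_combination hy - hz - e 0 * hadd')
  classical
  obtain ⟨Δ, hΔΨ, rfl⟩ := Finset.subset_set_image_iff.1 hΔ
  refine ⟨exConj Δ, fun N _ f a c => ⟨?_, ?_⟩⟩
  · rintro ⟨y, hy⟩
    exact (realize_exConj Δ f _).2 ⟨_, realizations_mono _ hΔΨ
      ((mem_realizations_artinSchreierType' hp a c _).2 ⟨y, hy, rfl⟩)⟩
  · rintro b ⟨y, hy⟩ hb hc
    obtain ⟨z, hz⟩ := (realize_exConj Δ f _).1 hc
    let e : Fin 4 → K.Points f := ![a, c, c - b, b]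
    let x : (Fin 4 × Fin K.arity) ⊕ (Bool × K.Wit p) → N :=
      Sum.elim (fun q => toTuple (e q.1) q.2) fun q => cond q.1 (z q.2) (witness p y q.2)
    refine hΔN N f x ?_ ((hΓ' N f x).2 ⟨?_, ?_, ?_⟩)
    · rw [Finset.coe_image, mem_realizations_relabel_map]
      convert hz using 1
      ext ((i | i) | i) <;> rfl
    · convert (mem_realizations_artinSchreierType' hp a (c - b) _).2 ⟨y, hy, rfl⟩ using 1
      ext ((i | i) | i) <;> rfl
    · rw [mem_realizations_systemType]
      refine ⟨e, fun s => rfl, ?_, by simp⟩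
      rintro _ rfl
      exact add_sub_cancel b c
    · convert hb using 2
      ext (m | i | i) <;> rfl

end Field

/-! ### Elementary extensions with many points -/

theorem nonempty_of_isInfinite (K : TypeDefinableField L M) (hinf : K.IsInfinite) :
    Nonempty M := by
  obtain ⟨N, _, f, h⟩ := hinf
  have : Nonempty N := by
    by_contra hN
    rw [not_nonempty_iff] at hN
    have : Subsingleton (K.Points f) := ⟨fun x y => toTuple_injective (funext fun i => hN.elim (toTuple x i))⟩
    exact not_finite (K.Points f)
  exact f.elementarilyEquivalent.nonempty_iff.2 this

/-- The infinite `K^N₁` need not be related to `N`. Each finite part of the type of `μ` distinct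
points is therefore pulled from `N₁` down to `M` and pushed up to `N`, where compactness applies. -/
theorem exists_le_mk_points (K : TypeDefinableField L M) (hinf : K.IsInfinite)
    {N : Type (max u v w)} [L.Structure N] (f : M ↪ₑ[L] N) (μ : Cardinal.{max u v w}) :
    ∃ (N' : Type (max u v w)) (_ : L.Structure N') (g : N ↪ₑ[L] N'),
      μ ≤ Cardinal.mk (K.Points (g.comp f)) := by
  classical
  have _ := K.nonempty_of_isInfinite hinf
  have _ : Nonempty N := f.elementarilyEquivalent.nonempty_iff.1 inferInstance
  obtain ⟨N₁, _, f₁, _⟩ := hinf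
  let D : Set (L.Formula (M ⊕ (μ.out × Fin K.arity))) :=
    {χ | ∃ q : μ.out × μ.out, q.1 ≠ q.2 ∧
      χ = neFormula (fun s => Sum.inr (q.1, s)) (fun s => Sum.inr (q.2, s))}
  let Γ : Set (L.Formula (M ⊕ (μ.out × Fin K.arity))) :=
    (⋃ i : μ.out, Formula.relabel (Sum.map id fun s => (i, s)) '' K.carrier) ∪ D
  have hfin : ∀ Δ : Finset (L.Formula (M ⊕ (μ.out × Fin K.arity))), (Δ : Set _) ⊆ Γ →
      ∃ x : μ.out × Fin K.arity → N₁,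
        x ∈ realizations f₁ (Δ : Set (L.Formula (M ⊕ (μ.out × Fin K.arity)))) := by
    intro Δ hΔ
    choose q hq hqχ using fun χ (hχ : χ ∈ D) => hχ
    let B : Finset μ.out :=
      Δ.biUnion fun χ => if h : χ ∈ D then {(q χ h).1, (q χ h).2} else ∅
    obtain ⟨e, he⟩ : ∃ e : μ.out → K.Points f₁, Set.InjOn e B := by
      refine ⟨fun i => Infinite.natEmbedding (K.Points f₁)
        (if h : i ∈ B then (B.equivFin ⟨i, h⟩ : ℕ) else 0), fun i hi j hj hij => ?_⟩
      have := (Infinite.natEmbedding (K.Points f₁)).injective hij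
      rw [dif_pos (Finset.mem_coe.1 hi), dif_pos (Finset.mem_coe.1 hj)] at this
      exact congrArg Subtype.val (B.equivFin.injective (Fin.ext this))
    refine ⟨fun s => toTuple (e s.1) s.2, fun χ hχ => ?_⟩
    rcases hΔ hχ with h | h
    · obtain ⟨i, φ, hφ, rfl⟩ := Set.mem_iUnion.1 h
      rw [Formula.realize_relabel]
      convert toTuple_mem (e i) φ hφ using 1
      ext (m | s) <;> rfl
    · have hB : (q χ h).1 ∈ B ∧ (q χ h).2 ∈ B := by
        constructor <;> refine Finset.mem_biUnion.2 ⟨χ, hχ, ?_⟩ <;> simp [h]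
      rw [hqχ χ h, realize_neFormula]
      intro heq
      exact hq χ h (he hB.1 hB.2 (toTuple_injective heq))
  obtain ⟨N', _, g, x, hx⟩ := exists_elementaryEmbedding_realizations.{u, v, max u v w} (M := N)
    (Formula.relabel (Sum.map f id) '' Γ) (by
      intro Δ hΔ
      obtain ⟨Δ, hΔΓ, rfl⟩ := Finset.subset_set_image_iff.1 hΔ
      obtain ⟨x, hx⟩ := hfin Δ hΔΓ
      obtain ⟨x, hx⟩ := exists_mem_realizations_of_elementaryEmbedding f₁ Δ hx
      refine ⟨f ∘ x, ?_⟩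
      rw [Finset.coe_image, mem_realizations_relabel]
      intro φ hφ
      convert (realize_comp_elementaryEmbedding id f φ x).2 (hx φ hφ) using 1
      ext (m | s) <;> rfl)
  have hx' : x ∈ realizations (g.comp f) Γ := by
    rw [mem_realizations_relabel] at hx
    intro φ hφ
    convert hx φ hφ using 1
    ext (m | s) <;> rfl
  rw [mem_realizations_union, mem_realizations_iUnion] at hx'
  simp only [mem_realizations_relabel_map] at hx'
  choose y hy using fun i => K.exists_toTuple_eq (g.comp f) (hx'.1 i)
  refine ⟨N', inferInstance, g, ?_⟩
  rw [← μ.mk_out]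
  refine Cardinal.mk_le_of_injective (f := y) fun i j hij => ?_
  by_contra hne
  refine (realize_neFormula _ _ _).1 (hx'.2 _ ⟨(i, j), hne, rfl⟩) ?_
  have := congrArg toTuple hij
  rw [hy, hy] at this
  exact this

end TypeDefinableField

/-! ### The dichotomy -/

open Cardinal TypeDefinableField in
/-- A type-definable infinite field of characteristic `p > 0` in an NIP theory has either no or
unboundedly many Artin-Schreier extensions. -/
theorem hasNoArtinSchreier_or_not_hasBoundedlyManyArtinSchreier {L : FirstOrder.Language.{u, v}}
    (T : L.Theory) (hT : IsNIP T) {M : Type w} [L.Structure M] [M ⊨ T]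
    (K : TypeDefinableField L M) (p : ℕ) (hp : p.Prime) (hchar : K.HasChar p)
    (hinf : K.IsInfinite) :
    K.HasNoArtinSchreier p ∨ ¬ K.HasBoundedlyManyArtinSchreier p := by
  classical
  by_contra! hcon
  obtain ⟨hne, κ₀, hκ₀⟩ := hcon
  have _ : Fact p.Prime := ⟨hp⟩
  have hM := K.nonempty_of_isInfinite hinf
  simp only [HasNoArtinSchreier, not_forall] at hne
  obtain ⟨N₀, _, f₀, hN₀⟩ := hne
  let Φ := Finset (L.Formula (M ⊕ ((Fin K.arity ⊕ Fin K.arity) ⊕ K.Wit p)))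
  let κ : Cardinal.{max u v w} := max (max κ₀ ℵ₀) #Φ
  have hκℵ : ℵ₀ ≤ κ := (le_max_right _ _).trans (le_max_left _ _)
  -- `N` is taken above `N₀`, where an extension exists, so that properness of the image can be
  -- transferred to `N`.
  obtain ⟨N, _, g, hg⟩ := K.exists_le_mk_points hinf f₀ (Order.succ (κ ^ Order.succ κ))
  let f := g.comp f₀
  have _ := hchar N₀ f₀
  have _ := hchar N f
  have hspec : ∀ a b : K.Points f, a * b ∉ artinSchreierImage p (K.Points f) → ∃ ψ : Φ,
      (ψ : Set _) ⊆ K.artinSchreierType p ∧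
        ¬ (exConj ψ).Realize (Sum.elim f (Sum.elim (toTuple a) (toTuple b))) := fun a b hab =>
    exists_finset_not_realize_exConj hp a b fun y hy => hab (mem_artinSchreierImage.2 ⟨y, hy⟩)
  have htop : artinSchreierImage p (K.Points f) ≠ ⊤ := by
    have h0 : ∃ c : K.Points f₀, c ∉ artinSchreierImage p (K.Points f₀) := by
      by_contra! hall
      exact hN₀ (artinSchreierExtensions_eq_empty ((AddSubgroup.eq_top_iff' _).2 hall))
    obtain ⟨c, hc⟩ := h0
    -- Failure of `1 * c = y ^ p - y` is witnessed by a first-order formula, so it persists from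
    -- `N₀` to `N`.
    obtain ⟨ψ, hψ, hψc⟩ := exists_finset_not_realize_exConj hp 1 c fun y hy =>
      hc (mem_artinSchreierImage.2 ⟨y, by rw [hy, one_mul]⟩)
    intro htop
    have hmap : ∀ x : K.Points f₀, ∃ x' : K.Points f, toTuple x' = g ∘ toTuple x := fun x =>
      K.exists_toTuple_eq f ((realizations_comp_elementaryEmbedding f₀ g K.carrier _).2
        (toTuple_mem x))
    obtain ⟨a', ha'⟩ := hmap 1
    obtain ⟨c', hc'⟩ := hmap c
    obtain ⟨y, hy⟩ := mem_artinSchreierImage.1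
      (htop ▸ AddSubgroup.mem_top (a' * c') : a' * c' ∈ artinSchreierImage p (K.Points f))
    refine hψc ((realize_comp_elementaryEmbedding f₀ g _ _).1 ?_)
    rw [Sum.comp_elim, ← ha', ← hc']
    exact (realize_exConj ψ f _).2 ⟨_, realizations_mono _ hψ
      ((mem_realizations_artinSchreierType' hp a' c' _).2 ⟨y, hy, rfl⟩)⟩
  obtain ⟨ψ, hpat⟩ := exists_pattern htop hκℵ
    (mk_quotient_artinSchreierImage_le.trans
      (max_le ((hκ₀ N f).trans ((le_max_left _ _).trans (le_max_left _ _))) hκℵ))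
    (Φ := Φ) (le_max_right _ _) (Order.succ_le_iff.1 hg)
    -- The colour of `(a, b)` is a finite part of the type that detects `a * b ∉ H`. The default `∅`
    -- plays no role, as the pattern only records colours of pairs with product outside `H`.
    (fun a b => if hab : a * b ∉ artinSchreierImage p (K.Points f) then (hspec a b hab).choose
      else ∅)
  have hψ : (ψ : Set _) ⊆ K.artinSchreierType p := by
    obtain ⟨a, b, -, hab, -⟩ := hpat 1
    rw [← (hab 0).2, dif_pos (hab 0).1]
    exact (hspec _ _ (hab 0).1).choose_spec.1
  obtain ⟨θ, hθ⟩ := exists_separating_formula hp hchar ψ hψ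
  have _ : N ⊨ T := (f.theory_model_iff T).1 inferInstance
  have _ : Nonempty N := f.elementarilyEquivalent.nonempty_iff.1 hM
  refine hT (hasIP_of_finite_patterns f θ fun n => ?_)
  obtain ⟨a, b, C, hab, hC⟩ := hpat n
  -- In the pattern `a i * C S ∈ H` goes with `i ∉ S`, hence the complement.
  refine ⟨fun i => toTuple (a i), fun I => toTuple (C Iᶜ), fun i I => ⟨fun h => ?_, fun h => ?_⟩⟩
  · by_contra hi
    refine (hθ N f (a i) (C Iᶜ)).2 (b i) (mem_artinSchreierImage.1 ((hC Iᶜ i).2 hi)) ?_ h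
    rw [← (hab i).2, dif_pos (hab i).1]
    exact (hspec _ _ (hab i).1).choose_spec.2
  · exact (hθ N f (a i) (C Iᶜ)).1 (mem_artinSchreierImage.1 ((hC Iᶜ i).1 (by simpa using h)))

end NIPFields

theorem proposition4p6 {L : FirstOrder.Language.{u, v}} (T : L.Theory) (hT : NIPFields.IsNIP T)
    {M : Type w} [L.Structure M] [M ⊨ T] (K : NIPFields.TypeDefinableField L M)
    (p : ℕ) (hp : p.Prime) (hchar : K.HasChar p) (hinf : K.IsInfinite) :
    K.HasNoArtinSchreier p ∨ ¬ K.HasBoundedlyManyArtinSchreier p :=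
  NIPFields.hasNoArtinSchreier_or_not_hasBoundedlyManyArtinSchreier T hT K p hp hchar hinf
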